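/- Consider the two-user Gaussian interference channel with real channel gains $h_{ij}$, in which receiver $i\in\{1,2\}$ observes $Y_{i,t}=h_{i1}X_{1,t}+h_{i2}X_{2,t}+\eta_{i,t}$, $t=1,\dots,T$, with $\eta_{i,t}$ i.i.d. $\mathcal N(0,1)$. A server holds two independent, uniformly distributed files $A,B$ of $F$ bits each. Before the requests are known, it fills transmitter caches $U_1,U_2$ of $F$ bits each and receiver caches $Z_1,Z_2$ of at most $MF$ bits each ($M\ge 0$) with functions of $(A,B)$. Then users $1,2$ request files $W_1,W_2\in\{A,B\}$; the requests are known to all nodes. Transmitter $i$ sends a sequence $X_i^T$ depending only on $U_i$ and the requests, subject to $\frac1T\sum_{t=1}^T X_{i,t}^2\le P$, and user $i$ computes an estimate $\hat W_i$ of $W_i$ from $Y_i^T$, $Z_i$ and the requests. A rate $R$ is achievable for $(M,P)$ if there are such strategies, one for each block length $T$, with $F/T\to R$ and $\Pr\{(\hat W_1,\hat W_2)\ne(W_1,W_2)\}\to0$ as $T\to\infty$ for every $(W_1,W_2)\in\{A,B\}^2$. Let $R^*(M,P)\in[0,\infty]$ be the supremum of the achievable rates, and let $$d^*(M)=\limsup_{P\to\infty}\frac{R^*(M,P)}{\frac12\log_2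 P}\in[0,\infty],$$ which is the limit whenever the limit exists. Put $1/0=\infty$ and $1/\infty=0$. Then, for all real channel gains and every $M\ge0$, $$\frac1{d^*(M)}\ge\max\left\{1-\tfrac12M,\,0\right\},$$ and in particular the same bound holds for $1/d$ if the limit exists and equals $d$. Moreover, for $M\ge\frac45$ the right-hand side coincides with the expression $$\max\left\{\tfrac32-\tfrac32M,\ \tfrac97-\tfrac67M,\ 1-\tfrac12M,\ 0\right\}.$$ -/

import Mathlib

open MeasureTheory ProbabilityTheory Filter Topology
open scoped NNReal ENNReal

noncomputable section

namespace CacheIC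

/-- A file of `F` bits. -/
abbrev File (F : ℕ) : Type := Fin F → Bool

/-- The server's library: two files of `F` bits, `w 0 = A` and `w 1 = B`. -/
abbrev Library (F : ℕ) : Type := Fin 2 → File F

/-- A demand pair `(W₁, W₂)`: user `i` requests the file with index `d i`. -/
abbrev Demand : Type := Fin 2 → Fin 2

/-- Content of a transmitter cache: `F` bits. -/
abbrev TxCache (F : ℕ) : Type := Fin F → Bool

/-- Content of a receiver cache: up to `M * F` bits. -/
abbrev RxCache (M : ℝ) (F : ℕ) : Type := Fin ⌊M * F⌋₊ → Bool

/-- A strategy (placement and delivery) for files of `F` bits, block length `T`, receiver memory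
`M` and power `P`. The caches are filled knowing both files but not the demands. Transmitter `i`
sees its own cache and the demands only; receiver `i` sees the demands, its own cache and its own
channel output. -/
structure Strategy (M P : ℝ) (F T : ℕ) where
  /-- Placement in the transmitter caches `U₁`, `U₂`. -/
  txPlace : Fin 2 → Library F → TxCache F
  /-- Placement in the receiver caches `Z₁`, `Z₂`. -/
  rxPlace : Fin 2 → Library F → RxCache M F
  /-- Channel input sequences. -/
  encode : Fin 2 → Demand → TxCache F → (Fin T → ℝ)
  /-- Decoded files. -/
  decode : Fin 2 → Demand → RxCache M F → (Fin T → ℝ) → File F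
  measurable_decode : ∀ i d z, Measurable (decode i d z)
  power_le : ∀ i d w, (1 / (T : ℝ)) * ∑ t, (encode i d (txPlace i w) t) ^ 2 ≤ P

/-- Law of the noise `η i t`, `i = 0, 1`, `t < T`: iid standard Gaussian. -/
def noise (T : ℕ) : Measure (Fin 2 → Fin T → ℝ) :=
  Measure.pi fun _ => Measure.pi fun _ => gaussianReal 0 1

namespace Strategy

variable {M P : ℝ} {F T : ℕ}

/-- Channel input of transmitter `i` when the library is `w` and the demands are `d`. -/
def input (s : Strategy M P F T) (d : Demand) (w : Library F) (i : Fin 2) : Fin T → ℝ :=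
  s.encode i d (s.txPlace i w)

/-- Channel output `Yᵢ = hᵢ₁ X₁ + hᵢ₂ X₂ + ηᵢ` at receiver `i`, for channel gains `h`. -/
def output (h : Matrix (Fin 2) (Fin 2) ℝ) (s : Strategy M P F T) (d : Demand) (w : Library F)
    (η : Fin 2 → Fin T → ℝ) (i : Fin 2) : Fin T → ℝ :=
  fun t => ∑ j, h i j * s.input d w j t + η i t

/-- The file decoded by user `i`. -/
def decoded (h : Matrix (Fin 2) (Fin 2) ℝ) (s : Strategy M P F T) (d : Demand) (w : Library F)
    (η : Fin 2 → Fin T → ℝ) (i : Fin 2) : File F :=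
  s.decode i d (s.rxPlace i w) (s.output h d w η i)

/-- Probability that some user does not recover its requested file, when the two files are
independent and uniformly distributed. -/
def errorProb (h : Matrix (Fin 2) (Fin 2) ℝ) (s : Strategy M P F T) (d : Demand) : ℝ≥0∞ :=
  (∑ w : Library F, noise T {η | ∃ i, s.decoded h d w η i ≠ w (d i)}) /
    (Fintype.card (Library F) : ℝ≥0∞)

end Strategy

/-- `(R, M, P)` is achievable: there are strategies, one for each block length `T`, whose rates
`F / T` tend to `R` and whose error probabilities tend to `0` for all demands. -/
def Achievable (h : Matrix (Fin 2) (Fin 2) ℝ) (R : ℝ≥0) (M P : ℝ) : Prop :=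
  ∃ (F : ℕ → ℕ) (s : ∀ T, Strategy M P (F T) T),
    Tendsto (fun T => (F T : ℝ) / (T : ℝ)) atTop (𝓝 (R : ℝ)) ∧
      ∀ d : Demand, Tendsto (fun T => (s T).errorProb h d) atTop (𝓝 0)

/-- The optimal rate `R*(M, P)`, in bits per channel use; it may be infinite. -/
def optimalRate (h : Matrix (Fin 2) (Fin 2) ℝ) (M P : ℝ) : ℝ≥0∞ :=
  ⨆ (R : ℝ≥0) (_ : Achievable h R M P), (R : ℝ≥0∞)

/-- The normalized optimal rate `R*(M, P) / (½ log₂ P)`. -/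
def normalizedRate (h : Matrix (Fin 2) (Fin 2) ℝ) (M P : ℝ) : ℝ≥0∞ :=
  optimalRate h M P / ENNReal.ofReal (1 / 2 * Real.logb 2 P)

/-- The optimal degrees of freedom `d*(M)`: the limit of `R*(M, P) / (½ log₂ P)` as `P → ∞`,
taken as an upper limit so that it is meaningful without assuming that the limit exists. -/
def optimalDoF (h : Matrix (Fin 2) (Fin 2) ℝ) (M : ℝ) : ℝ≥0∞ :=
  limsup (fun P : ℝ => normalizedRate h M P) atTop

end CacheIC

end

/-! This is a cut-set argument at a single receiver: its cache, together with its outputs under the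
demands `(A, A)` and `(B, B)`, determines both files. A change of measure replaces mutual
information. By the power constraint, every output law is at most `C = (√(1 + q) * exp (1 / 2)) ^ T`
times one fixed Gaussian law, with `q` of order `P` (`pi_gaussianReal_one_le_smul`). Under the fixed
law the output carries no information, so the chances of guessing both files, summed over all
libraries, are at most the number of cache contents (`sum_prod_measure_decode_le`). Hence `2 ^ (2 *
F) ≤ 2 * C ^ 2 * 2 ^ ⌊M * F⌋₊`; logarithms give `(2 - M) * R ≤ log₂ P + O(1)`, that is, `d ≤ 2 / (2
- M)`. -/

namespace MeasureTheory

/-- `OuterMeasure.pi` is the largest outer measure bounded by the product on boxes, so comparison on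
boxes suffices. -/
theorem Measure.pi_le_pi {ι : Type*} [Fintype ι] {α : ι → Type*} [∀ i, MeasurableSpace (α i)]
    {μ ν : ∀ i, Measure (α i)} [∀ i, SigmaFinite (μ i)] (hle : ∀ i, μ i ≤ ν i) :
    Measure.pi μ ≤ Measure.pi ν := by
  have key : (Measure.pi μ).toOuterMeasure ≤ OuterMeasure.pi fun i => (ν i).toOuterMeasure := by
    refine OuterMeasure.le_pi.2 fun s _ => ?_
    change Measure.pi μ (Set.pi Set.univ s) ≤ _
    rw [Measure.pi_pi]
    exact Finset.prod_le_prod' fun i _ => hle i (s i)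
  refine Measure.le_iff.2 fun s hs => ?_
  rw [Measure.pi_def (μ := ν), toMeasure_apply _ _ hs]
  exact key s

theorem Measure.pi_smul {ι : Type*} [Fintype ι] {α : ι → Type*} [∀ i, MeasurableSpace (α i)]
    (ν : ∀ i, Measure (α i)) [∀ i, SigmaFinite (ν i)] (c : ι → ℝ≥0) :
    Measure.pi (fun i => c i • ν i) = (∏ i, c i) • Measure.pi ν := by
  refine Measure.pi_eq fun s _ => ?_
  simp only [Measure.smul_apply, Measure.pi_pi, ENNReal.smul_def, smul_eq_mul,
    Finset.prod_mul_distrib, ENNReal.ofNNReal_finsetProd]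

end MeasureTheory

/-! ### Domination of shifted Gaussians by a centered one -/

namespace ProbabilityTheory

/-- Completing the square: the two exponents differ by `(q * y - (1 + q) * x) ^ 2 / (2 * q * (1 +
q))`. -/
theorem gaussianPDFReal_one_le (x y : ℝ) {q : ℝ≥0} (hq : 0 < q) :
    gaussianPDFReal x 1 y ≤
      √(1 + q) * Real.exp (x ^ 2 / (2 * q)) * gaussianPDFReal 0 (1 + q) y := by
  have hq' : (0 : ℝ) < q := hq
  have h1 : (0 : ℝ) < 1 + q := by positivity
  have h2 : 0 < √(2 * Real.pi) := by positivity
  have hexp : -(y - x) ^ 2 / (2 * 1) ≤ x ^ 2 / (2 * q) + -(y - 0) ^ 2 / (2 * (1 + q)) := by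
    have : x ^ 2 / (2 * q) + -(y - 0) ^ 2 / (2 * (1 + q)) - -(y - x) ^ 2 / (2 * 1)
        = (q * y - (1 + q) * x) ^ 2 / (2 * q * (1 + q)) := by
      field_simp
      ring
    have h3 : 0 ≤ (q * y - (1 + q) * x) ^ 2 / (2 * q * (1 + q)) := by positivity
    linarith
  simp only [gaussianPDFReal, NNReal.coe_one, NNReal.coe_add, mul_one]
  rw [Real.sqrt_mul (by positivity) (1 + (q : ℝ)), mul_inv]
  have h4 : √(1 + (q : ℝ)) ≠ 0 := by positivity
  calc (√(2 * Real.pi))⁻¹ * Real.exp (-(y - x) ^ 2 / 2)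
      ≤ (√(2 * Real.pi))⁻¹ * Real.exp (x ^ 2 / (2 * q) + -(y - 0) ^ 2 / (2 * (1 + q))) := by
        gcongr
        simpa using hexp
    _ = _ := by
        rw [Real.exp_add]
        field_simp

/-- A unit-variance Gaussian with mean `x` is dominated by a centered Gaussian of larger
variance. -/
theorem gaussianReal_one_le_smul (x : ℝ) {q : ℝ≥0} (hq : 0 < q) :
    gaussianReal x 1 ≤
      (√(1 + q) * Real.exp (x ^ 2 / (2 * q))).toNNReal • gaussianReal 0 (1 + q) := by
  rw [gaussianReal_of_var_ne_zero _ one_ne_zero,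
    gaussianReal_of_var_ne_zero _ (by positivity : (1 + q : ℝ≥0) ≠ 0)]
  change _ ≤ ((√(1 + q) * Real.exp (x ^ 2 / (2 * q))).toNNReal : ℝ≥0∞) •
    (volume : Measure ℝ).withDensity (gaussianPDF 0 (1 + q))
  rw [← withDensity_smul _ (measurable_gaussianPDF _ _)]
  refine withDensity_mono (Eventually.of_forall fun y => ?_)
  simp only [Pi.smul_apply, smul_eq_mul, gaussianPDF]
  rw [← ENNReal.ofReal, ← ENNReal.ofReal_mul (by positivity)]
  exact ENNReal.ofReal_le_ofReal (gaussianPDFReal_one_le x y hq)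

/-- The factors `exp (x t ^ 2 / (2 * q))` multiply to at most `exp (T / 2)`, so the constant is
uniform over inputs of bounded power. -/
theorem pi_gaussianReal_one_le_smul {T : ℕ} (x : Fin T → ℝ) {q : ℝ≥0} (hq : 0 < q)
    (hx : ∑ t, x t ^ 2 ≤ q * T) :
    Measure.pi (fun t => gaussianReal (x t) 1) ≤
      ENNReal.ofReal ((√(1 + q) * Real.exp (1 / 2)) ^ T) •
        Measure.pi fun _ : Fin T => gaussianReal 0 (1 + q) := by
  have hq' : (0 : ℝ) < q := hq
  refine (Measure.pi_le_pi fun t => gaussianReal_one_le_smul (x t) hq).trans ?_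
  rw [Measure.pi_smul]
  change ((∏ t, (√(1 + q) * Real.exp (x t ^ 2 / (2 * q))).toNNReal : ℝ≥0) : ℝ≥0∞) •
    Measure.pi (fun _ : Fin T => gaussianReal 0 (1 + q)) ≤ _
  rw [← Real.toNNReal_prod_of_nonneg fun t _ => by positivity, ← ENNReal.ofReal]
  refine Measure.le_iff.2 fun s _ => ?_
  simp only [Measure.smul_apply, smul_eq_mul]
  gcongr
  rw [Finset.prod_mul_distrib, ← Real.exp_sum, ← Finset.sum_div, mul_pow, ← Real.exp_nat_mul]
  simp only [Finset.prod_const, Finset.card_univ, Fintype.card_fin]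
  gcongr
  rw [div_le_iff₀ (by positivity)]
  linarith

end ProbabilityTheory

/-! ### Cut-set bound at finite block length -/

namespace CacheIC

/-- For a fixed cache content the decoding regions partition `Y`, so the sum over `w` factors into
total masses, each equal to 1. Replacing the actual content `z w` by a sum over all contents costs
the factor `card Z`. -/
theorem sum_prod_measure_decode_le {W Z Y : Type*} [Fintype W] [Fintype Z] {ι : Type*} [Fintype ι]
    [DecidableEq ι] [MeasurableSpace Y] [MeasurableSpace W] [MeasurableSingletonClass W]
    (ν : Measure Y) [IsProbabilityMeasure ν] (z : (ι → W) → Z) (g : ι → Z → Y → W)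
    (hg : ∀ i c, Measurable (g i c)) :
    ∑ w : ι → W, ∏ i, ν {y | g i (z w) y = w i} ≤ Fintype.card Z := by
  have hz : ∀ c : Z, ∑ w : ι → W, ∏ i, ν {y | g i c y = w i} = 1 := by
    intro c
    have h1 : ∀ i, ∑ a : W, ν {y | g i c y = a} = 1 := by
      intro i
      have := sum_measure_preimage_singleton (μ := ν) Finset.univ
        (fun a _ => hg i c (measurableSet_singleton a))
      simpa [Set.preimage] using this
    have := Finset.prod_univ_sum (fun _ : ι => (Finset.univ : Finset W))
      (fun i a => ν {y | g i c y = a})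
    simp only [h1, Finset.prod_const_one, Fintype.piFinset_univ] at this
    exact this.symm
  calc ∑ w : ι → W, ∏ i, ν {y | g i (z w) y = w i}
      ≤ ∑ w : ι → W, ∑ c : Z, ∏ i, ν {y | g i c y = w i} :=
        Finset.sum_le_sum fun w _ => Finset.single_le_sum
          (f := fun c => ∏ i, ν {y | g i c y = w i}) (fun _ _ => zero_le) (Finset.mem_univ (z w))
    _ = ∑ c : Z, ∑ w : ι → W, ∏ i, ν {y | g i c y = w i} := Finset.sum_comm
    _ = Fintype.card Z := by simp [hz]

variable {M P : ℝ} {F T : ℕ}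

instance : IsProbabilityMeasure (noise T) := by unfold noise; infer_instance

theorem noise_map_eval_add (i : Fin 2) (x : Fin T → ℝ) :
    (noise T).map (fun η t => x t + η i t) = Measure.pi fun t => gaussianReal (x t) 1 := by
  have h1 : (noise T).map (Function.eval i) = Measure.pi fun _ => gaussianReal 0 1 :=
    (measurePreserving_eval (fun _ : Fin 2 => Measure.pi fun _ : Fin T => gaussianReal 0 1) i).map_eq
  have h2 : (Measure.pi fun _ : Fin T => gaussianReal 0 1).map (fun y t => x t + y t) =
      Measure.pi fun t => gaussianReal (x t) 1 := by
    have hm : ∀ t, (gaussianReal 0 1).map (fun y => x t + y) = gaussianReal (x t) 1 := fun t => by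
      rw [gaussianReal_map_const_add, zero_add]
    have : ∀ t, SigmaFinite ((gaussianReal 0 1).map (fun y => x t + y)) := fun t => by
      rw [hm]; infer_instance
    rw [Measure.pi_map_pi (f := fun t y => x t + y) (fun t => by fun_prop)]
    simp only [hm]
  rw [← h2, ← h1, Measure.map_map (by fun_prop) (by fun_prop)]
  rfl

namespace Strategy

theorem sum_output_mean_sq_le (h : Matrix (Fin 2) (Fin 2) ℝ) (s : Strategy M P F T) (d : Demand)
    (w : Library F) (i : Fin 2) :
    ∑ t, (∑ j, h i j * s.input d w j t) ^ 2 ≤ (∑ j, h i j ^ 2) * (2 * P) * T := by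
  have hpow : ∀ j, ∑ t, s.input d w j t ^ 2 ≤ P * T := by
    intro j
    rcases T.eq_zero_or_pos with rfl | hT
    · simp
    · have hT' : (0 : ℝ) < T := by exact_mod_cast hT
      have := s.power_le j d w
      rwa [one_div, inv_mul_le_iff₀ hT', mul_comm] at this
  calc ∑ t, (∑ j, h i j * s.input d w j t) ^ 2
      ≤ ∑ t, (∑ j, h i j ^ 2) * ∑ j, s.input d w j t ^ 2 :=
        Finset.sum_le_sum fun t _ => Finset.sum_mul_sq_le_sq_mul_sq _ _ _
    _ = (∑ j, h i j ^ 2) * ∑ j, ∑ t, s.input d w j t ^ 2 := by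
        rw [← Finset.mul_sum, Finset.sum_comm]
    _ ≤ (∑ j, h i j ^ 2) * ∑ _j : Fin 2, P * T := by
        gcongr with j
        exact hpow j
    _ = _ := by simp; ring

theorem noise_decoded_eq_le (h : Matrix (Fin 2) (Fin 2) ℝ) (s : Strategy M P F T) (d : Demand)
    (w : Library F) (i : Fin 2) {q : ℝ≥0} (hq : 0 < q) (hqP : (∑ j, h i j ^ 2) * (2 * P) ≤ q) :
    noise T {η | s.decoded h d w η i = w (d i)} ≤
      ENNReal.ofReal ((√(1 + q) * Real.exp (1 / 2)) ^ T) *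
        Measure.pi (fun _ : Fin T => gaussianReal 0 (1 + q))
          {y | s.decode i d (s.rxPlace i w) y = w (d i)} := by
  set x : Fin T → ℝ := fun t => ∑ j, h i j * s.input d w j t with hx
  have hle := pi_gaussianReal_one_le_smul x hq
    ((s.sum_output_mean_sq_le h d w i).trans (by gcongr))
  have hmeas : MeasurableSet {y | s.decode i d (s.rxPlace i w) y = w (d i)} :=
    s.measurable_decode i d _ (measurableSet_singleton _)
  have := hle {y | s.decode i d (s.rxPlace i w) y = w (d i)}
  rw [← noise_map_eval_add i x, Measure.map_apply (by fun_prop) hmeas] at this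
  exact this

theorem card_library_le (h : Matrix (Fin 2) (Fin 2) ℝ) (s : Strategy M P F T) (i : Fin 2)
    {q : ℝ≥0} (hq : 0 < q) (hqP : (∑ j, h i j ^ 2) * (2 * P) ≤ q)
    (herr : ∀ k : Fin 2, s.errorProb h (fun _ => k) ≤ 1 / 4) :
    (2 : ℝ) ^ (2 * F) ≤ 2 * ((√(1 + q) * Real.exp (1 / 2)) ^ T) ^ 2 * 2 ^ ⌊M * F⌋₊ := by
  set C : ℝ := (√(1 + q) * Real.exp (1 / 2)) ^ T with hC
  set N : ℝ≥0∞ := (Fintype.card (Library F) : ℝ≥0∞) with hN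
  have hN0 : N ≠ 0 := by simp [hN]
  have hNt : N ≠ ∞ := ENNReal.natCast_ne_top _
  set a : Fin 2 → Library F → ℝ≥0∞ :=
    fun k w => noise T {η | s.decoded h (fun _ => k) w η i = w k} with ha
  set e : Fin 2 → Library F → ℝ≥0∞ :=
    fun k w => noise T {η | ∃ i, s.decoded h (fun _ => k) w η i ≠ w k} with he
  have hae : ∀ k w, 1 ≤ a k w + e k w := by
    intro k w
    rw [← measure_univ (μ := noise T)]
    refine (measure_mono fun η _ => ?_).trans (measure_union_le _ _)
    by_cases hη : s.decoded h (fun _ => k) w η i = w k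
    · exact Or.inl hη
    · exact Or.inr ⟨i, hη⟩
  -- The product stands for two independent uses of the channel, one per common demand; this is
  -- their union bound.
  have hone : ∀ w, 1 ≤ ∏ k, a k w + (e 0 w + e 1 w) := by
    intro w
    rw [Fin.prod_univ_two]
    calc 1 ≤ a 0 w * 1 + e 0 w := by rw [mul_one]; exact hae 0 w
      _ ≤ a 0 w * (a 1 w + e 1 w) + e 0 w := by gcongr; exact hae 1 w
      _ = a 0 w * a 1 w + (a 0 w * e 1 w + e 0 w) := by ring
      _ ≤ a 0 w * a 1 w + (1 * e 1 w + e 0 w) := by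
        gcongr
        exact prob_le_one (μ := noise T)
      _ = _ := by ring
  have hsum_e : ∀ k, ∑ w, e k w ≤ N * (1 / 4) := fun k =>
    (ENNReal.div_le_iff' hN0 hNt).1 (herr k)
  have hsum_a : ∑ w, ∏ k, a k w ≤ ENNReal.ofReal C ^ 2 * (2 : ℝ≥0∞) ^ ⌊M * F⌋₊ := by
    calc ∑ w, ∏ k, a k w
        ≤ ∑ w : Library F, ∏ k, (ENNReal.ofReal C *
            Measure.pi (fun _ : Fin T => gaussianReal 0 (1 + q))
              {y | s.decode i (fun _ => k) (s.rxPlace i w) y = w k}) :=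
          Finset.sum_le_sum fun w _ => Finset.prod_le_prod' fun k _ =>
            s.noise_decoded_eq_le h (fun _ => k) w i hq hqP
      _ = ENNReal.ofReal C ^ 2 * ∑ w : Library F, ∏ k,
            Measure.pi (fun _ : Fin T => gaussianReal 0 (1 + q))
              {y | s.decode i (fun _ => k) (s.rxPlace i w) y = w k} := by
          simp [Finset.prod_mul_distrib, Finset.mul_sum]
      _ ≤ ENNReal.ofReal C ^ 2 * Fintype.card (RxCache M F) := by
          gcongr
          exact sum_prod_measure_decode_le _ (s.rxPlace i)
            (fun k c => s.decode i (fun _ => k) c) fun k c => s.measurable_decode i _ c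
      _ = _ := by simp
  -- Two error probabilities of at most `1 / 4` use up half of `N`, whence the factor 2 in the
  -- conclusion.
  have hmain : N ≤ ENNReal.ofReal C ^ 2 * (2 : ℝ≥0∞) ^ ⌊M * F⌋₊ + (N * (1 / 4) + N * (1 / 4)) := by
    calc N = ∑ _w : Library F, (1 : ℝ≥0∞) := by simp [hN]
      _ ≤ ∑ w, (∏ k, a k w + (e 0 w + e 1 w)) := Finset.sum_le_sum fun w _ => hone w
      _ = ∑ w, ∏ k, a k w + (∑ w, e 0 w + ∑ w, e 1 w) := by simp [Finset.sum_add_distrib]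
      _ ≤ _ := by gcongr <;> apply_assumption
  have hC0 : 0 ≤ C := by positivity
  have hcast : N = ENNReal.ofReal (2 ^ (2 * F)) := by
    rw [ENNReal.ofReal_pow (by norm_num)]
    simp [hN, ← pow_mul, mul_comm]
  have h4 : (1 / 4 : ℝ≥0∞) = ENNReal.ofReal (1 / 4) := by
    rw [ENNReal.ofReal_div_of_pos (by norm_num)]; norm_num
  have h2 : (2 : ℝ≥0∞) = ENNReal.ofReal 2 := by norm_num
  rw [hcast, h4, h2, ← ENNReal.ofReal_pow hC0, ← ENNReal.ofReal_pow (by norm_num),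
    ← ENNReal.ofReal_mul (by positivity), ← ENNReal.ofReal_mul (by positivity),
    ← ENNReal.ofReal_add (by positivity) (by positivity),
    ← ENNReal.ofReal_add (by positivity) (by positivity),
    ENNReal.ofReal_le_ofReal_iff (by positivity)] at hmain
  linarith

/-- The finite block length cut-set bound for receiver `i`. -/
theorem rate_le (h : Matrix (Fin 2) (Fin 2) ℝ) (hM : 0 ≤ M) (s : Strategy M P F T) (i : Fin 2)
    {q : ℝ≥0} (hq : 0 < q) (hqP : (∑ j, h i j ^ 2) * (2 * P) ≤ q)
    (herr : ∀ k : Fin 2, s.errorProb h (fun _ => k) ≤ 1 / 4) :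
    (2 - M) * F ≤ 1 + T * Real.logb 2 (Real.exp 1 * (1 + q)) := by
  have hcard := s.card_library_le h i hq hqP herr
  have hsq : ((√(1 + q) * Real.exp (1 / 2)) ^ T) ^ 2 = (Real.exp 1 * (1 + q)) ^ T := by
    rw [← pow_mul, mul_comm T 2, pow_mul, mul_pow, Real.sq_sqrt (by positivity),
      ← Real.exp_nat_mul]
    norm_num [mul_comm]
  have hlog := Real.logb_le_logb_of_le one_lt_two (by positivity) hcard
  have hE : (0 : ℝ) < Real.exp 1 * (1 + q) := by positivity
  rw [hsq, Real.logb_mul (by positivity) (by positivity), Real.logb_mul (by positivity)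
    (by positivity)] at hlog
  simp only [Real.logb_pow, Real.logb_self_eq_one one_lt_two, mul_one] at hlog
  have hfl : (⌊M * F⌋₊ : ℝ) ≤ M * F := Nat.floor_le (by positivity)
  push_cast at hlog
  linarith

end Strategy

/-! ### Passage to the limits in block length and power -/

theorem Achievable.rate_le {h : Matrix (Fin 2) (Fin 2) ℝ} {R : ℝ≥0} (hM : 0 ≤ M)
    (hR : Achievable h R M P) (i : Fin 2) {q : ℝ≥0} (hq : 0 < q)
    (hqP : (∑ j, h i j ^ 2) * (2 * P) ≤ q) :
    (2 - M) * R ≤ Real.logb 2 (Real.exp 1 * (1 + q)) := by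
  obtain ⟨F, s, hF, herr⟩ := hR
  have hev : ∀ k : Fin 2, ∀ᶠ T in atTop, (s T).errorProb h (fun _ => k) ≤ 1 / 4 := fun k =>
    (herr fun _ => k).eventually_le_const (by norm_num)
  have hlim : Tendsto (fun T : ℕ => 1 / (T : ℝ) + Real.logb 2 (Real.exp 1 * (1 + q))) atTop
      (𝓝 (0 + Real.logb 2 (Real.exp 1 * (1 + q)))) :=
    tendsto_one_div_atTop_nhds_zero_nat.add_const _
  rw [zero_add] at hlim
  refine le_of_tendsto_of_tendsto (hF.const_mul (2 - M)) hlim ?_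
  filter_upwards [eventually_all.2 hev, eventually_gt_atTop 0] with T hT hT0
  have hT' : (0 : ℝ) < T := by exact_mod_cast hT0
  have := (s T).rate_le h hM i hq hqP hT
  rw [← mul_div_assoc, div_le_iff₀ hT', add_mul, one_div_mul_cancel hT'.ne']
  linarith

/-- The cut-set bound on the optimal rate. -/
theorem optimalRate_le (h : Matrix (Fin 2) (Fin 2) ℝ) (hM : 0 ≤ M) (hM2 : M < 2) (i : Fin 2)
    {q : ℝ≥0} (hq : 0 < q) (hqP : (∑ j, h i j ^ 2) * (2 * P) ≤ q) :
    optimalRate h M P ≤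
      ENNReal.ofReal (Real.logb 2 (Real.exp 1 * (1 + q)) / (2 - M)) := by
  refine iSup₂_le fun R hR => ?_
  rw [← ENNReal.ofReal_coe_nnreal]
  refine ENNReal.ofReal_le_ofReal ?_
  rw [le_div_iff₀ (by linarith), mul_comm]
  exact hR.rate_le hM i hq hqP

theorem normalizedRate_le (h : Matrix (Fin 2) (Fin 2) ℝ) (hM : 0 ≤ M) (hM2 : M < 2) (i : Fin 2)
    (hP : 1 < P) :
    normalizedRate h M P ≤ ENNReal.ofReal (2 / (2 - M) *
      (1 + Real.logb 2 (Real.exp 1 * (2 + 2 * ∑ j, h i j ^ 2)) / Real.logb 2 P)) := by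
  have hP0 : 0 < P := by linarith
  have hK : 0 ≤ ∑ j, h i j ^ 2 := by positivity
  have hM' : 0 < 2 - M := by linarith
  have hlP : 0 < Real.logb 2 P := Real.logb_pos one_lt_two hP
  -- The 1 in this choice of `q` keeps it positive even when all gains to receiver `i` vanish.
  have hq : (0 : ℝ) < (1 + 2 * ∑ j, h i j ^ 2) * P := by positivity
  have hopt := optimalRate_le (P := P) h hM hM2 i (q := ⟨_, hq.le⟩) hq (by
    change _ ≤ (1 + 2 * ∑ j, h i j ^ 2) * P
    linarith)
  rw [normalizedRate]
  refine ENNReal.div_le_of_le_mul ?_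
  refine hopt.trans ?_
  rw [← ENNReal.ofReal_mul (by
    have : 0 ≤ Real.logb 2 (Real.exp 1 * (2 + 2 * ∑ j, h i j ^ 2)) :=
      Real.logb_nonneg one_lt_two (by nlinarith [Real.add_one_le_exp (1 : ℝ)])
    positivity)]
  refine ENNReal.ofReal_le_ofReal ?_
  change Real.logb 2 (Real.exp 1 * (1 + (1 + 2 * ∑ j, h i j ^ 2) * P)) / (2 - M) ≤ _
  have hle : Real.logb 2 (Real.exp 1 * (1 + (1 + 2 * ∑ j, h i j ^ 2) * P)) ≤
      Real.logb 2 (Real.exp 1 * (2 + 2 * ∑ j, h i j ^ 2)) + Real.logb 2 P := by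
    rw [← Real.logb_mul (by positivity) (by positivity), mul_assoc (Real.exp 1)]
    refine Real.logb_le_logb_of_le one_lt_two (by positivity) ?_
    gcongr
    linarith
  calc _ ≤ (Real.logb 2 (Real.exp 1 * (2 + 2 * ∑ j, h i j ^ 2)) + Real.logb 2 P) / (2 - M) := by
        gcongr
    _ = _ := by field_simp; ring

theorem optimalDoF_le (h : Matrix (Fin 2) (Fin 2) ℝ) (hM : 0 ≤ M) (hM2 : M < 2) :
    optimalDoF h M ≤ ENNReal.ofReal (2 / (2 - M)) := by
  set c := Real.logb 2 (Real.exp 1 * (2 + 2 * ∑ j, h 0 j ^ 2))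
  have hlim : Tendsto (fun P : ℝ => ENNReal.ofReal (2 / (2 - M) * (1 + c / Real.logb 2 P))) atTop
      (𝓝 (ENNReal.ofReal (2 / (2 - M)))) := by
    refine ENNReal.tendsto_ofReal ?_
    have := (((Real.tendsto_logb_atTop one_lt_two).const_div_atTop c).const_add 1).const_mul
      (2 / (2 - M))
    simpa using this
  rw [optimalDoF, ← hlim.limsup_eq]
  refine limsup_le_limsup ?_
  filter_upwards [eventually_gt_atTop 1] with P hP
  exact normalizedRate_le h hM hM2 0 hP

theorem ofReal_le_one_div_optimalDoF (h : Matrix (Fin 2) (Fin 2) ℝ) (hM : 0 ≤ M) :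
    ENNReal.ofReal (max (1 - M / 2) 0) ≤ 1 / optimalDoF h M := by
  rcases lt_or_ge M 2 with hM2 | hM2
  · have hpos : 0 < 2 / (2 - M) := div_pos two_pos (by linarith)
    rw [max_eq_left (by linarith), one_div]
    have : 1 - M / 2 = (2 / (2 - M))⁻¹ := by rw [inv_div]; ring
    rw [this, ENNReal.ofReal_inv_of_pos hpos]
    exact ENNReal.inv_le_inv.2 (optimalDoF_le h hM hM2)
  -- For `M ≥ 2` the cache can hold both files, and the bound is trivial.
  · rw [max_eq_right (by linarith)]
    simp

end CacheIC

theorem theorem3 (h : Matrix (Fin 2) (Fin 2) ℝ) (M : ℝ) (hM : 0 ≤ M) :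
    ENNReal.ofReal (max (1 - M / 2) 0) ≤ 1 / CacheIC.optimalDoF h M ∧
    (∀ d : ENNReal,
      Filter.Tendsto (fun P : ℝ => CacheIC.normalizedRate h M P) Filter.atTop (nhds d) →
        ENNReal.ofReal (max (1 - M / 2) 0) ≤ 1 / d) ∧
    (4 / 5 ≤ M →
      max (max (3 / 2 - 3 / 2 * M) (9 / 7 - 6 / 7 * M)) (max (1 - 1 / 2 * M) 0) =
        max (1 - M / 2) 0) := by
  refine ⟨CacheIC.ofReal_le_one_div_optimalDoF h hM, fun d hd => ?_, fun hM' => ?_⟩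
  · have hlimsup : CacheIC.optimalDoF h M = d := hd.limsup_eq
    rw [← hlimsup]
    exact CacheIC.ofReal_le_one_div_optimalDoF h hM
  · rw [show 1 - 1 / 2 * M = 1 - M / 2 by ring]
    -- The first line falls below `1 - M / 2` from `M = 1 / 2` on, the second exactly from `M = 4 /
    -- 5` on.
    refine max_eq_right (max_le ?_ ?_)
    · exact le_max_of_le_left (by linarith)
    · exact le_max_of_le_left (by linarith)
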